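/- For an integer $M\ge 2$, an integer $J\ge 0$, real $a>0$, complex $b$ and real $w>0$ put $$F_{a,b,M}(w)=\sum_{n\ge 1}\sum_{k=1}^{M-1}\Big[(Mn-k)^b e^{-w(Mn-k)^a}-(Mn)^b e^{-w(Mn)^a}\Big],\qquad \Phi_{a,b,M,J}(w)=(-1)^J\frac{d^J}{dw^J}F_{a,b,M}(w),$$ where $x^y=e^{y\ln x}$ for $x>0$. **Theorem.** Let $M\ge 2$ and $J\ge 0$ be integers and let $z\in\mathbb R$. (1) Let $a>0$ be real and let $b\in\mathbb C$ satisfy $\operatorname{Re} b>-Ja-1$. Then the series over $n$ defining $F_{a,b,M}(w)$ converges absolutely for every $w>0$, $F_{a,b,M}$ is $J$ times continuously differentiable on $(0,\infty)$, and, with absolute convergence, $$\sum_{n\in\mathbb Z}M^{(Ja+1+b)(n+z)}\,\Phi_{a,b,M,J}\big(M^{a(n+z)}\big)=\frac1a\,\Gamma\Big(\frac{1+b}{a}+J\Big).$$ (2) (Exponential function, $a=1$.) Let $g_M(w)=\frac{1}{e^w-1}-\frac{M}{e^{Mw}-1}$. For every integer $\beta\ge 0$ and every $w>0$, $\Phi_{1,\beta,M,J}(w)=(-1)^{J+\beta}g_M^{(J+\beta)}(w)$.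 Moreover, with absolute convergence, $$\sum_{n\in\mathbb Z}M^{(J+1)(n+z)}\,(-1)^J g_M^{(J)}\big(M^{n+z}\big)=J!.$$ (3) (Jacobi theta function, $a=2$.) Let $\theta(w)=\sum_{n\in\mathbb Z}e^{-wn^2}$ and $h_M(w)=\frac12\big(\theta(w)-M\theta(M^2w)-1+M\big)$. For every integer $\beta\ge 0$ and every $w>0$, $\Phi_{2,2\beta,M,J}(w)=(-1)^{J+\beta}h_M^{(J+\beta)}(w)$. Moreover, with absolute convergence, $$\sum_{n\in\mathbb Z}M^{(2J+1)(n+z)}\,(-1)^J h_M^{(J)}\big(M^{2(n+z)}\big)=\frac12\,\Gamma\Big(J+\frac12\Big).$$ -/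

import Mathlib

/-- The complex number `m ^ b * exp (-w * m ^ a)`, used for real `m > 0`. -/
noncomputable def expPowTerm (a : ℝ) (b : ℂ) (m w : ℝ) : ℂ :=
  (m : ℂ) ^ b * Complex.exp (-((w * m ^ a : ℝ) : ℂ))

/-- The finite inner sum over `1 ≤ k ≤ M - 1`, for the `n`-th block (`n ≥ 1`). -/
noncomputable def blockTerm (a : ℝ) (b : ℂ) (M : ℕ) (w : ℝ) (n : ℕ+) : ℂ :=
  ∑ k ∈ Finset.Icc 1 (M - 1),
    (expPowTerm a b ((M : ℝ) * (n : ℝ) - (k : ℝ)) w - expPowTerm a b ((M : ℝ) * (n : ℝ)) w)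

/-- The sum of the blocks over all `n ≥ 1`, as a function of `w` (meaningful for `w > 0`). -/
noncomputable def blockSum (a : ℝ) (b : ℂ) (M : ℕ) (w : ℝ) : ℂ :=
  ∑' n : ℕ+, blockTerm a b M w n

/-- `Φ_{a,b,M,J}(w)`: the `J`-th derivative in `w` of the block sum, times `(-1) ^ J`. -/
noncomputable def PhiFun (a : ℝ) (b : ℂ) (M J : ℕ) (w : ℝ) : ℂ :=
  (-1) ^ J * iteratedDeriv J (blockSum a b M) w

/-- `1 / (e ^ w - 1) - M / (e ^ (M w) - 1)`. -/
noncomputable def expKernel (M : ℕ) (w : ℝ) : ℝ :=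
  1 / (Real.exp w - 1) - (M : ℝ) / (Real.exp ((M : ℝ) * w) - 1)

/-- The Jacobi theta function `θ(w) = ∑_{n ∈ ℤ} exp (-w n ^ 2)`, `w > 0`, expressed through
Mathlib's `jacobiTheta τ = ∑_{n ∈ ℤ} exp (π i n ^ 2 τ)` at `τ = i w / π`. -/
noncomputable def thetaReal (w : ℝ) : ℂ :=
  jacobiTheta (Complex.I * (w : ℂ) / (Real.pi : ℂ))

/-- `(θ(w) - M θ(M ^ 2 w) - 1 + M) / 2`. -/
noncomputable def thetaKernel (M : ℕ) (w : ℝ) : ℂ :=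
  (thetaReal w - (M : ℂ) * thetaReal ((M : ℝ) ^ 2 * w) - 1 + (M : ℂ)) / 2

open Filter Topology MeasureTheory Set

/-! The sum over `n : ℤ` telescopes. Write P_c(w) = ∑_{m ≥ 1} m^c e^{-w m^a} (`powSum`). The terms
at multiples of M rescale, so the block sum is P_c(w) - M^{1+c} P_c(M^a w). Each w-derivative turns
b into b + a up to sign, so Φ is the block sum with exponent c = b + J a, and Re c > -1.

With t_n = M^{n+z} and H(n) = t_n^{1+c} P_c(t_n^a), the n-th summand is H(n) - H(n+1). By scaling,
H(n) is a Riemann sum of step t_n for f(x) = x^c e^{-x^a} on (0, ∞). Hence H → 0 at +∞, while at -∞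
it tends to ∫ f = Γ((1+c)/a)/a, which is the value of the sum.

A mean value bound |f'(x)| ≤ D x^{-s} controls both the summands (`exists_norm_blockSum_le`) and the
Riemann sum error (`exists_norm_powSum_sub_integral_le`) by a multiple of t^{2-s}. Taking s > 2 as t
→ ∞ and s < 2 as t → 0 gives geometric decay at both ends, hence absolute convergence. -/

/-! ### Power sums with exponential weight, and their derivatives -/

lemma exists_rpow_mul_exp_neg_le {q : ℝ} (hq : 0 ≤ q) :
    ∃ C : ℝ, 0 < C ∧ ∀ y : ℝ, 0 < y → y ^ q * Real.exp (-y) ≤ C := by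
  -- The 1 covers y ≤ 1; the factorial comes from y^k / k! ≤ e^y with k = ⌈q⌉.
  refine ⟨1 + (Nat.factorial ⌈q⌉₊ : ℝ), by positivity, fun y hy => ?_⟩
  rw [Real.exp_neg, ← div_eq_mul_inv, div_le_iff₀ (Real.exp_pos y)]
  have h1 : y ^ q ≤ 1 + y ^ ⌈q⌉₊ := by
    rcases le_total y 1 with h | h
    · have := Real.rpow_le_one hy.le h hq
      have : 0 < y ^ ⌈q⌉₊ := by positivity
      linarith
    · have := Real.rpow_le_rpow_of_exponent_le h (Nat.le_ceil q)
      rw [Real.rpow_natCast] at this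
      linarith
  have h2 := Real.pow_div_factorial_le_exp y hy.le ⌈q⌉₊
  rw [div_le_iff₀ (by positivity)] at h2
  have h3 := Real.one_le_exp hy.le
  linarith

lemma exists_rpow_mul_exp_neg_mul_rpow_le {a w p : ℝ} (ha : 0 < a) (hw : 0 < w) (hp : 0 ≤ p) :
    ∃ C : ℝ, 0 < C ∧ ∀ x : ℝ, 0 < x → x ^ p * Real.exp (-(w * x ^ a)) ≤ C := by
  obtain ⟨C, hC, h⟩ := exists_rpow_mul_exp_neg_le (div_nonneg hp ha.le)
  refine ⟨C / w ^ (p / a), by positivity, fun x hx => ?_⟩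
  have h1 := h (w * x ^ a) (by positivity)
  rw [Real.mul_rpow hw.le (by positivity), ← Real.rpow_mul hx.le, mul_div_cancel₀ _ ha.ne'] at h1
  rw [le_div_iff₀ (by positivity)]
  linarith

lemma norm_expPowTerm {a m : ℝ} (b : ℂ) (w : ℝ) (hm : 0 < m) :
    ‖expPowTerm a b m w‖ = m ^ b.re * Real.exp (-(w * m ^ a)) := by
  rw [expPowTerm, norm_mul, Complex.norm_cpow_eq_rpow_re_of_pos hm, ← Complex.ofReal_neg,
    Complex.norm_exp_ofReal]

/-- The exponential absorbs any power at infinity; `hs` keeps x^(Re b + s) bounded near 0, so one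
constant serves the whole half-line. -/
lemma exists_norm_expPowTerm_le {a w s : ℝ} {b : ℂ} (ha : 0 < a) (hw : 0 < w) (hs : -b.re ≤ s) :
    ∃ C : ℝ, 0 < C ∧ ∀ x : ℝ, 0 < x → ‖expPowTerm a b x w‖ ≤ C * x ^ (-s) := by
  obtain ⟨C, hC, h⟩ := exists_rpow_mul_exp_neg_mul_rpow_le (p := b.re + s) ha hw (by linarith)
  refine ⟨C, hC, fun x hx => ?_⟩
  have h1 := h x hx
  rw [norm_expPowTerm b w hx, Real.rpow_neg hx.le, ← div_eq_mul_inv, le_div_iff₀ (by positivity)]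
  rw [Real.rpow_add hx] at h1
  linarith

lemma summable_nat_add_one_rpow_neg {s : ℝ} (hs : 1 < s) :
    Summable fun n : ℕ => ((n : ℝ) + 1) ^ (-s) := by
  have := (summable_nat_add_iff 1).2 (Real.summable_nat_rpow.2 (by linarith : -s < -1))
  simpa using this

lemma summable_norm_expPowTerm {a w : ℝ} (b : ℂ) (ha : 0 < a) (hw : 0 < w) :
    Summable fun n : ℕ => ‖expPowTerm a b ((n : ℝ) + 1) w‖ := by
  obtain ⟨C, -, h⟩ := exists_norm_expPowTerm_le (s := max 2 (-b.re)) ha hw (le_max_right _ _)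
  exact .of_nonneg_of_le (fun _ => norm_nonneg _) (fun n => h _ (by positivity))
    ((summable_nat_add_one_rpow_neg
      (lt_of_lt_of_le one_lt_two (le_max_left _ _))).mul_left C)

/-- The series `∑_{m ≥ 1} m ^ b * exp (-w * m ^ a)`. -/
noncomputable def powSum (a : ℝ) (b : ℂ) (w : ℝ) : ℂ :=
  ∑' n : ℕ, expPowTerm a b ((n : ℝ) + 1) w

lemma hasSum_powSum {a w : ℝ} (b : ℂ) (ha : 0 < a) (hw : 0 < w) :
    HasSum (fun n : ℕ => expPowTerm a b ((n : ℝ) + 1) w) (powSum a b w) :=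
  (summable_norm_expPowTerm b ha hw).of_norm.hasSum

lemma hasDerivAt_expPowTerm {a m : ℝ} (b : ℂ) (w : ℝ) (hm : 0 < m) :
    HasDerivAt (expPowTerm a b m) (-expPowTerm a (b + a) m w) w := by
  have h : HasDerivAt (fun w : ℝ => -((w * m ^ a : ℝ) : ℂ)) (-((m ^ a : ℝ) : ℂ)) w := by
    have := ((hasDerivAt_id w).mul_const (m ^ a)).neg.ofReal_comp
    simpa using this
  have h2 := (h.cexp).const_mul ((m : ℂ) ^ b)
  refine h2.congr_deriv ?_
  rw [expPowTerm, Complex.cpow_add _ _ (by exact_mod_cast hm.ne'), Complex.ofReal_cpow hm.le]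
  ring

lemma hasDerivAt_powSum {a w : ℝ} (b : ℂ) (ha : 0 < a) (hw : 0 < w) :
    HasDerivAt (powSum a b) (-powSum a (b + a) w) w := by
  -- Termwise differentiation takes place on (w/2, ∞), where the terms at w/2 dominate the
  -- derivatives.
  have hw2 : 0 < w / 2 := by positivity
  rw [powSum, ← tsum_neg]
  refine hasDerivAt_tsum_of_isPreconnected (summable_norm_expPowTerm (b + a) ha hw2)
    (isOpen_Ioi (a := w / 2)) isPreconnected_Ioi
    (fun n y _ => hasDerivAt_expPowTerm b y (by positivity)) (fun n y hy => ?_)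
    (half_lt_self hw) (hasSum_powSum b ha hw).summable (half_lt_self hw)
  have hn : (0 : ℝ) < (n : ℝ) + 1 := by positivity
  rw [norm_neg, norm_expPowTerm _ _ hn, norm_expPowTerm _ _ hn]
  have : w / 2 < y := hy
  gcongr

/-! ### The block sum in terms of power sums -/

lemma expPowTerm_mul {a r m : ℝ} (b : ℂ) (w : ℝ) (hr : 0 < r) (hm : 0 < m) :
    expPowTerm a b (r * m) w = (r : ℂ) ^ b * expPowTerm a b m (r ^ a * w) := by
  rw [expPowTerm, expPowTerm, Complex.ofReal_mul r m,
    Complex.mul_cpow_ofReal_nonneg hr.le hm.le, Real.mul_rpow hr.le hm.le]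
  rw [show w * (r ^ a * m ^ a) = r ^ a * w * m ^ a by ring, mul_assoc]

/-- Adding the vanishing k = 0 term completes each block to M consecutive integers. -/
lemma blockTerm_eq (a : ℝ) (b : ℂ) {M : ℕ} (hM : 0 < M) (w : ℝ) (n : ℕ+) :
    blockTerm a b M w n = ∑ k ∈ Finset.range M, expPowTerm a b ((M : ℝ) * n - k) w -
      M * expPowTerm a b ((M : ℝ) * n) w := by
  have h : blockTerm a b M w n = ∑ k ∈ Finset.range M,
      (expPowTerm a b ((M : ℝ) * n - k) w - expPowTerm a b ((M : ℝ) * n) w) := by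
    refine Finset.sum_subset (fun k hk => ?_) (fun k hk hk' => ?_)
    · simp only [Finset.mem_Icc, Finset.mem_range] at *
      omega
    · simp only [Finset.mem_Icc, Finset.mem_range] at *
      obtain rfl : k = 0 := by omega
      simp
  simp [h]

/-- Division with remainder by M. Remainders are listed downwards so that, with f indexed from m =
1, the k-th entry of block n sits at M(n+1) - k. -/
lemma HasSum.blocks {f : ℕ → ℂ} {S : ℂ} (hf : HasSum f S) {M : ℕ} (hM : 0 < M) :
    HasSum (fun n : ℕ => ∑ k ∈ Finset.range M, f (n * M + (M - 1 - k))) S := by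
  have : NeZero M := ⟨hM.ne'⟩
  have h := ((Nat.divModEquiv M).symm.hasSum_iff.2 hf).prod_fiberwise fun q => hasSum_fintype _
  refine h.congr_fun fun n => ?_
  simp only [Function.comp_def, Nat.divModEquiv_symm_apply]
  rw [Fin.sum_univ_eq_sum_range (fun r => f (n * M + r)) M]
  exact Finset.sum_range_reflect (fun r => f (n * M + r)) M

lemma hasSum_blockTerm {a w : ℝ} (b : ℂ) {M : ℕ} (ha : 0 < a) (hM : 0 < M) (hw : 0 < w) :
    HasSum (blockTerm a b M w)
      (powSum a b w - M * (M : ℂ) ^ b * powSum a b ((M : ℝ) ^ a * w)) := by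
  have hM' : (0 : ℝ) < M := by exact_mod_cast hM
  have h1 := ((hasSum_powSum b ha hw).blocks hM)
  have h2 := (hasSum_powSum b ha (mul_pos (Real.rpow_pos_of_pos hM' a) hw)).mul_left
    (M * (M : ℂ) ^ b)
  refine (Equiv.pnatEquivNat.hasSum_iff.2 (h1.sub h2)).congr_fun fun n => ?_
  have hn : (n : ℝ) = (n.natPred : ℝ) + 1 := by
    rw [← Nat.cast_add_one, PNat.natPred_add_one]
  rw [blockTerm_eq a b hM]
  simp only [Function.comp_def, Equiv.pnatEquivNat_apply]
  congr 1
  · refine Finset.sum_congr rfl fun k hk => ?_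
    have hk' : k + 1 ≤ M := Finset.mem_range.1 hk
    congr 1
    rw [Nat.sub_sub, hn]
    push_cast [Nat.cast_sub (show 1 + k ≤ M by omega)]
    ring
  · rw [expPowTerm_mul b w hM' (by rw [hn]; positivity), hn]
    push_cast
    ring

lemma blockSum_eq {a w : ℝ} (b : ℂ) {M : ℕ} (ha : 0 < a) (hM : 0 < M) (hw : 0 < w) :
    blockSum a b M w = powSum a b w - M * (M : ℂ) ^ b * powSum a b ((M : ℝ) ^ a * w) :=
  (hasSum_blockTerm b ha hM hw).tsum_eq

lemma hasDerivAt_blockSum {a w : ℝ} (b : ℂ) {M : ℕ} (ha : 0 < a) (hM : 0 < M) (hw : 0 < w) :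
    HasDerivAt (blockSum a b M) (-blockSum a (b + a) M w) w := by
  have hM' : (0 : ℝ) < M := by exact_mod_cast hM
  have hMa : 0 < (M : ℝ) ^ a := Real.rpow_pos_of_pos hM' a
  have h1 := hasDerivAt_powSum b ha hw
  have h2 : HasDerivAt (fun w => powSum a b ((M : ℝ) ^ a * w))
      (((M : ℝ) ^ a) • -powSum a (b + a) ((M : ℝ) ^ a * w)) w :=
    HasDerivAt.scomp w (hasDerivAt_powSum b ha (mul_pos hMa hw))
      (by simpa using (hasDerivAt_id w).const_mul ((M : ℝ) ^ a))
  have h3 := h1.sub (h2.const_mul (M * (M : ℂ) ^ b))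
  refine (h3.congr_deriv ?_).congr_of_eventuallyEq ?_
  · rw [blockSum_eq _ ha hM hw, Complex.cpow_add _ _ (by exact_mod_cast hM.ne'),
      Complex.real_smul, Complex.ofReal_cpow hM'.le]
    push_cast
    ring
  · filter_upwards [lt_mem_nhds hw] with x hx
    exact blockSum_eq b ha hM hx

lemma iteratedDeriv_blockSum {a : ℝ} {M : ℕ} (ha : 0 < a) (hM : 0 < M) (J : ℕ) (b : ℂ) {w : ℝ}
    (hw : 0 < w) :
    iteratedDeriv J (blockSum a b M) w = (-1) ^ J * blockSum a (b + J * a) M w := by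
  induction J generalizing w with
  | zero => simp
  | succ J ih =>
    have h : iteratedDeriv J (blockSum a b M) =ᶠ[𝓝 w]
        fun w => (-1) ^ J * blockSum a (b + J * a) M w := by
      filter_upwards [lt_mem_nhds hw] with x hx
      exact ih hx
    rw [iteratedDeriv_succ, h.deriv_eq,
      ((hasDerivAt_blockSum (b + J * a) ha hM hw).const_mul _).deriv,
      show b + J * a + a = b + ((J + 1 : ℕ) : ℂ) * a by push_cast; ring]
    ring

lemma PhiFun_eq {a w : ℝ} (b : ℂ) {M : ℕ} (J : ℕ) (ha : 0 < a) (hM : 0 < M) (hw : 0 < w) :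
    PhiFun a b M J w = blockSum a (b + J * a) M w := by
  rw [PhiFun, iteratedDeriv_blockSum ha hM J b hw, ← mul_assoc, ← mul_pow]
  simp

lemma contDiffOn_blockSum {a : ℝ} {M : ℕ} (ha : 0 < a) (hM : 0 < M) (J : ℕ) (b : ℂ) :
    ContDiffOn ℝ (J : WithTop ℕ∞) (blockSum a b M) (Ioi 0) := by
  induction J generalizing b with
  | zero =>
    exact contDiffOn_zero.2 fun w hw =>
      (hasDerivAt_blockSum b ha hM hw).continuousAt.continuousWithinAt
  | succ J ih =>
    push_cast
    refine (contDiffOn_succ_iff_deriv_of_isOpen isOpen_Ioi).2 ⟨fun w hw =>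
      (hasDerivAt_blockSum b ha hM hw).differentiableAt.differentiableWithinAt, by simp, ?_⟩
    exact (ih (b + a)).neg.congr fun w hw => (hasDerivAt_blockSum b ha hM hw).deriv

/-! ### Mean value estimates for x^c e^{-x^a} -/

lemma hasDerivAt_expPowTerm_base (a : ℝ) (c : ℂ) {x : ℝ} (hx : 0 < x) :
    HasDerivAt (fun x : ℝ => expPowTerm a c x 1)
      (c * expPowTerm a (c - 1) x 1 - a * expPowTerm a (c + a - 1) x 1) x := by
  have hx' : (x : ℂ) ≠ 0 := by exact_mod_cast hx.ne'
  have h1 : HasDerivAt (fun x : ℝ => (x : ℂ) ^ c) (c * (x : ℂ) ^ (c - 1)) x := by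
    have := ((hasDerivAt_id (x : ℂ)).cpow_const (c := c)
      (Complex.ofReal_mem_slitPlane.2 hx)).comp_ofReal
    simpa using this
  have h2 : HasDerivAt (fun x : ℝ => -((1 * x ^ a : ℝ) : ℂ)) (-((a * x ^ (a - 1) : ℝ) : ℂ)) x := by
    have := (Real.hasDerivAt_rpow_const (p := a) (Or.inl hx.ne')).ofReal_comp.neg
    simpa only [one_mul] using! this
  refine (h1.mul h2.cexp).congr_deriv ?_
  rw [expPowTerm, expPowTerm, show c + a - 1 = c + (a - 1 : ℂ) by ring,
    Complex.cpow_add c _ hx', Complex.ofReal_mul a, Complex.ofReal_cpow hx.le]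
  push_cast
  ring

lemma exists_norm_expPowTerm_sub_le {a s : ℝ} {c : ℂ} (ha : 0 < a) (hs : 0 ≤ s)
    (hcs : 1 - c.re ≤ s) :
    ∃ D : ℝ, 0 < D ∧ ∀ x y : ℝ, 0 < x → x ≤ y →
      ‖expPowTerm a c y 1 - expPowTerm a c x 1‖ ≤ D * x ^ (-s) * (y - x) := by
  obtain ⟨C₁, hC₁, h₁⟩ := exists_norm_expPowTerm_le (b := c - 1) (s := s) ha one_pos
    (by simp; linarith)
  obtain ⟨C₂, hC₂, h₂⟩ := exists_norm_expPowTerm_le (b := c + a - 1) (s := s) ha one_pos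
    (by simp; linarith)
  refine ⟨‖c‖ * C₁ + a * C₂, by positivity, fun x y hx hxy => ?_⟩
  have key := (convex_Icc x y).norm_image_sub_le_of_norm_hasDerivWithin_le
    (f := fun x : ℝ => expPowTerm a c x 1) (C := (‖c‖ * C₁ + a * C₂) * x ^ (-s))
    (fun u hu => (hasDerivAt_expPowTerm_base a c (hx.trans_le hu.1)).hasDerivWithinAt)
    (fun u hu => ?_) (left_mem_Icc.2 hxy) (right_mem_Icc.2 hxy)
  · rwa [Real.norm_of_nonneg (sub_nonneg.2 hxy)] at key
  · have hu0 : 0 < u := hx.trans_le hu.1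
    -- Since s ≥ 0, the derivative bound on [x, y] is worst at the left endpoint.
    have hux : u ^ (-s) ≤ x ^ (-s) := Real.rpow_le_rpow_of_nonpos hx hu.1 (by linarith)
    calc _ ≤ ‖c‖ * ‖expPowTerm a (c - 1) u 1‖ + a * ‖expPowTerm a (c + a - 1) u 1‖ := by
          refine (norm_sub_le _ _).trans_eq ?_
          rw [norm_mul, norm_mul, Complex.norm_of_nonneg ha.le]
      _ ≤ ‖c‖ * (C₁ * x ^ (-s)) + a * (C₂ * x ^ (-s)) := by
          gcongr
          · exact (h₁ u hu0).trans (by gcongr)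
          · exact (h₂ u hu0).trans (by gcongr)
      _ = _ := by ring

lemma expPowTerm_scale {a t m : ℝ} (c : ℂ) (ht : 0 < t) (hm : 0 < m) :
    (t : ℂ) ^ c * expPowTerm a c m (t ^ a) = expPowTerm a c (t * m) 1 := by
  rw [expPowTerm_mul c 1 ht hm, mul_one]

lemma rpow_mul_self_mul_self {t : ℝ} (ht : 0 < t) (s : ℝ) : t ^ (-s) * t * t = t ^ (2 - s) := by
  rw [show 2 - s = -s + 1 + 1 by ring, Real.rpow_add_one ht.ne', Real.rpow_add_one ht.ne']

/-- After scaling, each difference compares f at points at most tM apart, both at least tn. It is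
therefore at most D (tn)^{-s} tM, and s > 1 makes the sum over n converge; the prefactor supplies
one more t. -/
lemma exists_norm_blockSum_le {a s : ℝ} {c : ℂ} {M : ℕ} (ha : 0 < a) (hM : 0 < M) (hs : 1 < s)
    (hcs : 1 - c.re ≤ s) :
    ∃ D : ℝ, ∀ t : ℝ, 0 < t → ‖(t : ℂ) ^ (1 + c) * blockSum a c M (t ^ a)‖ ≤ D * t ^ (2 - s) := by
  obtain ⟨D, hD, h⟩ := exists_norm_expPowTerm_sub_le ha (by linarith) hcs
  have hsum : Summable fun n : ℕ+ => (n : ℝ) ^ (-s) := by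
    refine (Equiv.pnatEquivNat.summable_iff.2 (summable_nat_add_one_rpow_neg hs)).congr fun n => ?_
    rw [Function.comp_apply, Equiv.pnatEquivNat_apply, ← Nat.cast_add_one, PNat.natPred_add_one]
  refine ⟨M * M * D * ∑' n : ℕ+, (n : ℝ) ^ (-s), fun t ht => ?_⟩
  have ht' : (t : ℂ) ≠ 0 := by exact_mod_cast ht.ne'
  rw [blockSum, ← tsum_mul_left, ← rpow_mul_self_mul_self ht]
  have hsum2 := hsum.hasSum.mul_left (M * M * D * (t ^ (-s) * t * t))
  rw [show M * M * D * (∑' n : ℕ+, (n : ℝ) ^ (-s)) * (t ^ (-s) * t * t) =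
    M * M * D * (t ^ (-s) * t * t) * ∑' n : ℕ+, (n : ℝ) ^ (-s) by ring]
  refine tsum_of_norm_bounded hsum2 fun n => ?_
  have hn : (1 : ℝ) ≤ n := by exact_mod_cast n.pos
  have hMr : (1 : ℝ) ≤ M := by exact_mod_cast hM
  have heq : (t : ℂ) ^ (1 + c) * blockTerm a c M (t ^ a) n =
      t * ∑ k ∈ Finset.Icc 1 (M - 1), (expPowTerm a c (t * (M * n - k)) 1 -
        expPowTerm a c (t * (M * n)) 1) := by
    rw [Complex.cpow_add _ _ ht', Complex.cpow_one, blockTerm, mul_assoc, Finset.mul_sum]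
    congr 1
    refine Finset.sum_congr rfl fun k hk => ?_
    have hk2 : k + 1 ≤ M := by have := Finset.mem_Icc.1 hk; omega
    have hk3 : (k : ℝ) + 1 ≤ M := by exact_mod_cast hk2
    rw [mul_sub, expPowTerm_scale c ht (by nlinarith), expPowTerm_scale c ht (by positivity)]
  rw [heq, norm_mul, Complex.norm_of_nonneg ht.le]
  have hterm : ∀ k ∈ Finset.Icc 1 (M - 1), ‖expPowTerm a c (t * (M * n - k)) 1 -
      expPowTerm a c (t * (M * n)) 1‖ ≤ D * (t ^ (-s) * (n : ℝ) ^ (-s)) * (t * M) := by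
    intro k hk
    have hk2 : k + 1 ≤ M := by have := Finset.mem_Icc.1 hk; omega
    have hk3 : (k : ℝ) + 1 ≤ M := by exact_mod_cast hk2
    have hge : (n : ℝ) ≤ M * n - k := by nlinarith
    have hk0 : (0 : ℝ) ≤ k := by positivity
    rw [norm_sub_rev]
    refine (h _ _ (by apply mul_pos ht; linarith) (by gcongr; linarith)).trans ?_
    rw [← Real.mul_rpow ht.le (by linarith)]
    have : t * (M * n) - t * (M * n - k) ≤ t * M := by nlinarith
    have h2 : (t * (M * n - k)) ^ (-s) ≤ (t * n) ^ (-s) :=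
      Real.rpow_le_rpow_of_nonpos (by positivity) (by gcongr) (by linarith)
    have h3 : 0 ≤ t * (M * n) - t * (M * n - k) := by nlinarith
    gcongr
  have hcard : ((Finset.Icc 1 (M - 1)).card : ℝ) ≤ M := by
    rw [Nat.card_Icc]; exact_mod_cast (by omega)
  calc _ ≤ t * ((Finset.Icc 1 (M - 1)).card * (D * (t ^ (-s) * (n : ℝ) ^ (-s)) * (t * M))) := by
        gcongr
        refine (norm_sum_le_of_le _ hterm).trans_eq ?_
        rw [Finset.sum_const, nsmul_eq_mul]
    _ ≤ t * (M * (D * (t ^ (-s) * (n : ℝ) ^ (-s)) * (t * M))) := by gcongr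
    _ = _ := by ring

/-! ### The Gamma integral and its Riemann sums -/

lemma gamma_integrand_comp_rpow {a x : ℝ} (c : ℂ) (ha : 0 < a) (hx : 0 < x) :
    (a * x ^ (a - 1)) • ((a : ℂ)⁻¹ * (((Real.exp (-(x ^ a)) : ℝ) : ℂ) *
      ((x ^ a : ℝ) : ℂ) ^ ((1 + c) / a - 1))) = expPowTerm a c x 1 := by
  have hx' : (x : ℂ) ≠ 0 := by exact_mod_cast hx.ne'
  have ha' : (a : ℂ) ≠ 0 := by exact_mod_cast ha.ne'
  have h : (x : ℂ) ^ c = ((x ^ (a - 1) : ℝ) : ℂ) * (x : ℂ) ^ (a * ((1 + c) / a - 1)) := by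
    rw [Complex.ofReal_cpow hx.le, ← Complex.cpow_add _ _ hx']
    congr 1
    push_cast
    field_simp
    ring
  rw [expPowTerm, h, Complex.real_smul, ← Complex.cpow_mul_ofReal_nonneg hx.le, one_mul]
  push_cast
  field_simp

lemma integrableOn_expPowTerm {a : ℝ} {c : ℂ} (ha : 0 < a) (hc : -1 < c.re) :
    IntegrableOn (fun x : ℝ => expPowTerm a c x 1) (Ioi 0) := by
  have hre : 0 < ((1 + c) / a).re := by
    rw [Complex.div_ofReal_re]; exact div_pos (by simp; linarith) ha
  have h := (integrableOn_Ioi_comp_rpow_iff _ ha.ne').2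
    ((Complex.GammaIntegral_convergent hre).const_mul (a : ℂ)⁻¹)
  refine h.congr_fun (fun x hx => ?_) measurableSet_Ioi
  rw [← gamma_integrand_comp_rpow c ha hx, abs_of_pos ha]

lemma integral_expPowTerm {a : ℝ} {c : ℂ} (ha : 0 < a) (hc : -1 < c.re) :
    ∫ x in Ioi (0 : ℝ), expPowTerm a c x 1 = Complex.Gamma ((1 + c) / a) / a := by
  have hre : 0 < ((1 + c) / a).re := by
    rw [Complex.div_ofReal_re]; exact div_pos (by simp; linarith) ha
  rw [Complex.Gamma_eq_integral hre, Complex.GammaIntegral, div_eq_inv_mul,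
    ← MeasureTheory.integral_const_mul]
  refine Eq.trans ?_ (integral_comp_rpow_Ioi_of_pos ha)
  exact setIntegral_congr_fun measurableSet_Ioi
    fun x hx => (gamma_integrand_comp_rpow c ha hx).symm

/-- Left-endpoint Riemann sum with nodes t, 2t, …. Comparing with the integral from t rather than
from 0 avoids the possible singularity at 0. -/
lemma exists_norm_powSum_sub_integral_le {a s : ℝ} {c : ℂ} (ha : 0 < a) (hc : -1 < c.re)
    (hs : 1 < s) (hcs : 1 - c.re ≤ s) :
    ∃ D : ℝ, ∀ t : ℝ, 0 < t → ‖(t : ℂ) ^ (1 + c) * powSum a c (t ^ a) -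
      ∫ x in Ioi t, expPowTerm a c x 1‖ ≤ D * t ^ (2 - s) := by
  obtain ⟨D, hD, h⟩ := exists_norm_expPowTerm_sub_le ha (by linarith) hcs
  have hsum := summable_nat_add_one_rpow_neg hs
  refine ⟨D * ∑' n : ℕ, ((n : ℝ) + 1) ^ (-s), fun t ht => ?_⟩
  have ht' : (t : ℂ) ≠ 0 := by exact_mod_cast ht.ne'
  set f : ℝ → ℂ := fun x => expPowTerm a c x 1 with hf
  have hint := integrableOn_expPowTerm ha hc
  set p : ℕ → ℝ := fun n => t * (n + 1) with hp
  have hp0 : ∀ n, 0 < p n := fun n => by positivity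
  have hpt : ∀ n, p (n + 1) = p n + t := fun n => by simp only [hp]; push_cast; ring
  have hii : ∀ n, IntervalIntegrable f volume (p n) (p (n + 1)) := fun n => by
    rw [intervalIntegrable_iff_integrableOn_Ioc_of_le (by rw [hpt]; linarith)]
    exact hint.mono_set fun x hx => (hp0 n).trans hx.1
  have hterm : ∀ n, ‖(t : ℂ) * f (p n) - ∫ x in p n..p (n + 1), f x‖ ≤
      D * t ^ (2 - s) * ((n : ℝ) + 1) ^ (-s) := fun n => by
    have h1 : (t : ℂ) * f (p n) = ∫ x in p n..p (n + 1), f (p n) := by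
      rw [intervalIntegral.integral_const, hpt, add_sub_cancel_left, Complex.real_smul]
    rw [h1, ← intervalIntegral.integral_sub intervalIntegrable_const (hii n)]
    refine (intervalIntegral.norm_integral_le_of_norm_le_const
      (C := D * (p n) ^ (-s) * t) fun x hx => ?_).trans_eq ?_
    · rw [uIoc_of_le (by rw [hpt]; linarith), hpt] at hx
      rw [norm_sub_rev]
      refine (h _ _ (hp0 n) hx.1.le).trans ?_
      have := (hp0 n).le
      have := hx.2
      gcongr
      linarith
    · rw [hpt, add_sub_cancel_left, abs_of_pos ht, ← rpow_mul_self_mul_self ht, hp,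
        Real.mul_rpow ht.le (by positivity)]
      ring
  have hlim1 : Tendsto (fun N => ∑ n ∈ Finset.range N, (t : ℂ) * f (p n)) atTop
      (𝓝 ((t : ℂ) ^ (1 + c) * powSum a c (t ^ a))) := by
    have := ((hasSum_powSum c ha (Real.rpow_pos_of_pos ht a)).mul_left
      ((t : ℂ) ^ (1 + c))).tendsto_sum_nat
    refine this.congr fun N => Finset.sum_congr rfl fun n _ => ?_
    rw [Complex.cpow_add _ _ ht', Complex.cpow_one, mul_assoc,
      expPowTerm_scale c ht (by positivity)]
  have hlim2 : Tendsto (fun N => ∑ n ∈ Finset.range N, ∫ x in p n..p (n + 1), f x) atTop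
      (𝓝 (∫ x in Ioi t, f x)) := by
    have htop : Tendsto p atTop atTop :=
      (tendsto_natCast_atTop_atTop.atTop_add tendsto_const_nhds).const_mul_atTop ht
    have := intervalIntegral_tendsto_integral_Ioi t
      (hint.mono_set (Ioi_subset_Ioi ht.le)) htop
    refine this.congr fun N => ?_
    rw [intervalIntegral.sum_integral_adjacent_intervals fun k _ => hii k]
    simp [hp, hf]
  refine le_of_tendsto ((hlim1.sub hlim2).norm) (Eventually.of_forall fun N => ?_)
  rw [← Finset.sum_sub_distrib]
  refine (norm_sum_le_of_le _ fun n _ => hterm n).trans ?_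
  rw [← Finset.mul_sum, mul_right_comm]
  gcongr
  exact hsum.sum_le_tsum _ fun n _ => by positivity

/-! ### Two-sided telescoping -/

lemma hasSum_int_sub_add_one {H : ℤ → ℂ} {A : ℂ}
    (hp : Summable fun n : ℕ => H n - H (n + 1))
    (hm : Summable fun n : ℕ => H (-(n + 1)) - H (-(n + 1) + 1))
    (htop : Tendsto (fun n : ℕ => H n) atTop (𝓝 0))
    (hbot : Tendsto (fun n : ℕ => H (-n)) atTop (𝓝 A)) :
    HasSum (fun n : ℤ => H n - H (n + 1)) A := by
  have h1 : HasSum (fun n : ℕ => H n - H (n + 1)) (H 0 - 0) := by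
    rw [hp.hasSum_iff_tendsto_nat]
    refine (tendsto_const_nhds.sub htop).congr fun N => ?_
    have := Finset.sum_range_sub' (fun n : ℕ => H n) N
    push_cast at this
    exact this.symm
  have h2 : HasSum (fun n : ℕ => H (-(n + 1)) - H (-(n + 1) + 1)) (A - H 0) := by
    rw [hm.hasSum_iff_tendsto_nat]
    refine (hbot.sub tendsto_const_nhds).congr fun N => ?_
    have := Finset.sum_range_sub (fun n : ℕ => H (-n)) N
    push_cast at this
    rw [neg_zero] at this
    rw [← this]
    refine Finset.sum_congr rfl fun n _ => ?_
    rw [show -((n : ℤ) + 1) + 1 = -n by ring]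
  have := h1.of_nat_of_neg_add_one (f := fun n : ℤ => H n - H (n + 1)) h2
  rwa [show H 0 - 0 + (A - H 0) = A by ring] at this

lemma hasSum_blockSum {a : ℝ} {c : ℂ} {M : ℕ} (hM : 2 ≤ M) (z : ℝ) (ha : 0 < a)
    (hc : -1 < c.re) :
    HasSum (fun n : ℤ => (((M : ℝ) ^ ((n : ℝ) + z) : ℝ) : ℂ) ^ (1 + c) *
      blockSum a c M (((M : ℝ) ^ ((n : ℝ) + z)) ^ a)) (Complex.Gamma ((1 + c) / a) / a) := by
  have hM0 : 0 < M := by omega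
  have hM1 : (1 : ℝ) < M := by exact_mod_cast hM
  have hMpos : (0 : ℝ) < M := by linarith
  set t : ℤ → ℝ := fun n => (M : ℝ) ^ ((n : ℝ) + z) with ht
  have htpos : ∀ n, 0 < t n := fun n => Real.rpow_pos_of_pos hMpos _
  have ht1 : ∀ n, t (n + 1) = M * t n := fun n => by
    simp only [ht]
    push_cast
    rw [show (n : ℝ) + 1 + z = n + z + 1 by ring, Real.rpow_add_one hMpos.ne', mul_comm]
  set f : ℝ → ℂ := fun x => expPowTerm a c x 1 with hf
  set H : ℤ → ℂ := fun n => (t n : ℂ) ^ (1 + c) * powSum a c (t n ^ a) with hH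
  have hdiff : ∀ n, H n - H (n + 1) = (t n : ℂ) ^ (1 + c) * blockSum a c M (t n ^ a) := fun n => by
    simp only [hH]
    rw [blockSum_eq c ha hM0 (Real.rpow_pos_of_pos (htpos n) a), ht1,
      Real.mul_rpow hMpos.le (htpos n).le, Complex.ofReal_mul,
      Complex.mul_cpow_ofReal_nonneg hMpos.le (htpos n).le, Complex.ofReal_natCast,
      Complex.cpow_add 1 c (x := (M : ℂ)) (by exact_mod_cast hM0.ne'), Complex.cpow_one]
    ring
  -- Makes s = 2 - ε admissible as t → 0: ε < 1 gives s > 1, ε ≤ 1 + Re c gives s ≥ 1 - Re c, and ε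
  -- > 0 gives decay t^ε. As t → ∞, s = 3 gives t^{-1}.
  obtain ⟨ε, hε0, hε1, hεc⟩ : ∃ ε : ℝ, 0 < ε ∧ ε < 1 ∧ ε ≤ 1 + c.re :=
    ⟨min (1 / 2) (1 + c.re), lt_min (by norm_num) (by linarith),
      (min_le_left _ _).trans_lt (by norm_num), min_le_right _ _⟩
  have hpow_top : ∀ n : ℕ, t n ^ (2 - 3 : ℝ) = (M : ℝ) ^ (-z) * ((M : ℝ) ^ (-1 : ℝ)) ^ n := by
    intro n
    simp only [ht]
    rw [← Real.rpow_mul hMpos.le, ← Real.rpow_natCast, ← Real.rpow_mul hMpos.le,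
      ← Real.rpow_add hMpos]
    congr 1
    push_cast
    ring
  have hpow_bot : ∀ n : ℕ, t (-n) ^ (2 - (2 - ε)) = (M : ℝ) ^ (ε * z) * ((M : ℝ) ^ (-ε)) ^ n := by
    intro n
    simp only [ht]
    rw [← Real.rpow_mul hMpos.le, ← Real.rpow_natCast, ← Real.rpow_mul hMpos.le,
      ← Real.rpow_add hMpos]
    congr 1
    push_cast
    ring
  have hgeo : ∀ δ : ℝ, 0 < δ → ∀ K : ℝ, Summable fun n : ℕ => K * ((M : ℝ) ^ (-δ)) ^ n := by
    intro δ hδ K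
    exact (summable_geometric_of_lt_one (by positivity)
      (Real.rpow_lt_one_of_one_lt_of_neg hM1 (by linarith))).mul_left K
  have hsum_top : ∀ D, Summable fun n : ℕ => D * t n ^ (2 - 3 : ℝ) := fun D => by
    simp only [hpow_top]
    exact (hgeo 1 one_pos _).mul_left D
  have hsum_bot : ∀ D, Summable fun n : ℕ => D * t (-n) ^ (2 - (2 - ε)) := fun D => by
    simp only [hpow_bot]
    exact (hgeo ε hε0 _).mul_left D
  have htop : Tendsto (fun n : ℕ => t n) atTop atTop :=
    (tendsto_rpow_atTop_of_base_gt_one _ hM1).comp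
      (tendsto_atTop_add_const_right _ z tendsto_natCast_atTop_atTop)
  have hbot : Tendsto (fun n : ℕ => t (-n)) atTop (𝓝 0) := by
    have h1 : Tendsto (fun n : ℕ => -(n : ℝ) + z) atTop atBot :=
      tendsto_atBot_add_const_right _ z (tendsto_neg_atTop_atBot.comp tendsto_natCast_atTop_atTop)
    have := (tendsto_rpow_atBot_of_base_gt_one _ hM1).comp h1
    simpa [Function.comp_def, ht] using this
  have hint := integrableOn_expPowTerm ha hc
  have hInt_top : Tendsto (fun n : ℕ => ∫ x in Ioi (t n), f x) atTop (𝓝 0) :=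
    tendsto_integral_Ioi_zero htop
  have hInt_bot : Tendsto (fun n : ℕ => ∫ x in Ioi (t (-n)), f x) atTop
      (𝓝 (Complex.Gamma ((1 + c) / a) / a)) := by
    rw [← integral_expPowTerm ha hc]
    refine ((aecover_Ioi_of_Ioi hbot).integral_tendsto_of_countably_generated hint).congr
      fun n => ?_
    rw [Measure.restrict_restrict measurableSet_Ioi, inter_eq_left.2 (Ioi_subset_Ioi (htpos _).le)]
  have squeeze : ∀ (u v : ℕ → ℂ) (g : ℕ → ℝ) (L : ℂ), Summable g → (∀ n, ‖u n - v n‖ ≤ g n) →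
      Tendsto v atTop (𝓝 L) → Tendsto u atTop (𝓝 L) := fun u v g L hg huv hv => by
    have := (squeeze_zero_norm huv hg.tendsto_atTop_zero).add hv
    simpa using this
  have key := hasSum_int_sub_add_one (H := H) (A := Complex.Gamma ((1 + c) / a) / a) ?_ ?_ ?_ ?_
  · exact key.congr_fun fun n => (hdiff n).symm
  · obtain ⟨D, hD⟩ := exists_norm_blockSum_le (c := c) (s := 3) ha hM0 (by norm_num) (by linarith)
    refine .of_norm_bounded (hsum_top D) fun n => ?_
    rw [hdiff]
    exact hD _ (htpos _)
  · obtain ⟨D, hD⟩ := exists_norm_blockSum_le (c := c) (s := 2 - ε) ha hM0 (by linarith)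
      (by linarith)
    refine .of_norm_bounded ((summable_nat_add_iff 1).2 (hsum_bot D)) fun n => ?_
    rw [hdiff]
    exact_mod_cast hD _ (htpos _)
  · obtain ⟨D, hD⟩ := exists_norm_powSum_sub_integral_le (s := 3) ha hc (by norm_num)
      (by linarith)
    exact squeeze _ _ _ _ (hsum_top D) (fun n => hD _ (htpos n)) hInt_top
  · obtain ⟨D, hD⟩ := exists_norm_powSum_sub_integral_le (s := 2 - ε) ha hc (by linarith)
      (by linarith)
    exact squeeze _ _ _ _ (hsum_bot D) (fun n => hD _ (htpos (-n))) hInt_bot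

lemma hasSum_PhiFun {a : ℝ} {b : ℂ} {M : ℕ} (J : ℕ) (hM : 2 ≤ M) (z : ℝ) (ha : 0 < a)
    (hb : -((J : ℝ) * a) - 1 < b.re) :
    HasSum
      (fun n : ℤ =>
        (M : ℂ) ^ (((J : ℂ) * (a : ℂ) + 1 + b) * ((n : ℂ) + (z : ℂ))) *
          PhiFun a b M J ((M : ℝ) ^ (a * ((n : ℝ) + z))))
      (Complex.Gamma ((1 + b) / (a : ℂ) + (J : ℂ)) / (a : ℂ)) := by
  have hM0 : 0 < M := by omega
  have hMpos : (0 : ℝ) < M := by exact_mod_cast hM0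
  have ha' : (a : ℂ) ≠ 0 := by exact_mod_cast ha.ne'
  have h := hasSum_blockSum (c := b + J * a) hM z ha (by simp; linarith)
  rw [show (1 + (b + J * a)) / (a : ℂ) = (1 + b) / a + J by field_simp; ring] at h
  refine h.congr_fun fun n => ?_
  rw [PhiFun_eq b J ha hM0 (Real.rpow_pos_of_pos hMpos _), ← Complex.cpow_mul_ofReal_nonneg hMpos.le,
    ← Real.rpow_mul hMpos.le, mul_comm a]
  congr 2
  push_cast
  ring

/-! ### The exponential and theta kernels -/

lemma iteratedDeriv_ofReal_comp (f : ℝ → ℝ) (n : ℕ) :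
    iteratedDeriv n (fun x => (f x : ℂ)) = fun x => ((iteratedDeriv n f x : ℝ) : ℂ) := by
  induction n with
  | zero => simp
  | succ n ih =>
    ext x
    rw [iteratedDeriv_succ, iteratedDeriv_succ, ih]
    by_cases h : DifferentiableAt ℝ (iteratedDeriv n f) x
    · exact h.hasDerivAt.ofReal_comp.deriv
    -- No smoothness is needed: where the real function is not differentiable, neither is its
    -- complexification (take real parts), and both derivatives default to 0.
    · rw [deriv_zero_of_not_differentiableAt h, deriv_zero_of_not_differentiableAt]
      · simp
      · exact fun h' => h ((Complex.reCLM.differentiableAt.comp x h').congr_of_eventuallyEq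
          (Eventually.of_forall fun _ => rfl))

/-- Starting from exponent 0, β differentiations produce exponent aβ up to sign, so both sides are
the block sum with exponent (J + β)a. -/
lemma PhiFun_eq_iteratedDeriv {a w : ℝ} {M : ℕ} {g : ℝ → ℂ} (ha : 0 < a) (hM : 0 < M)
    (hg : ∀ w : ℝ, 0 < w → blockSum a 0 M w = g w) (β J : ℕ) (hw : 0 < w) :
    PhiFun a (a * β) M J w = (-1) ^ (J + β) * iteratedDeriv (J + β) g w := by
  have h : blockSum a 0 M =ᶠ[𝓝 w] g := by
    filter_upwards [lt_mem_nhds hw] with x hx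
    exact hg x hx
  rw [← h.iteratedDeriv_eq, iteratedDeriv_blockSum ha hM (J + β) 0 hw, PhiFun_eq _ J ha hM hw,
    ← mul_assoc, ← mul_pow]
  simp only [mul_neg, mul_one, neg_neg, one_pow, one_mul]
  congr 1
  push_cast
  ring

lemma powSum_one_zero {w : ℝ} (hw : 0 < w) :
    powSum 1 0 w = ((1 / (Real.exp w - 1) : ℝ) : ℂ) := by
  have hlt : Real.exp (-w) < 1 := by simpa using hw
  have h := (hasSum_geometric_of_lt_one (Real.exp_pos (-w)).le hlt).mul_left (Real.exp (-w))
  have h2 := Complex.hasSum_ofReal.2 h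
  have h1 := Real.one_lt_exp_iff.2 hw
  rw [show Real.exp (-w) * (1 - Real.exp (-w))⁻¹ = 1 / (Real.exp w - 1) by
    have h3 : Real.exp w - 1 ≠ 0 := by linarith
    rw [Real.exp_neg] at hlt ⊢
    have h4 : 1 - (Real.exp w)⁻¹ ≠ 0 := by linarith
    field_simp] at h2
  refine (h2.congr_fun fun n => ?_).tsum_eq
  rw [expPowTerm, Complex.cpow_zero, one_mul, ← Complex.ofReal_neg, ← Complex.ofReal_exp,
    ← Real.exp_nat_mul, ← Real.exp_add, Real.rpow_one]
  congr 2
  ring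

lemma blockSum_one_zero {M : ℕ} (hM : 0 < M) {w : ℝ} (hw : 0 < w) :
    blockSum 1 0 M w = (expKernel M w : ℂ) := by
  have hMpos : (0 : ℝ) < M := by exact_mod_cast hM
  rw [blockSum_eq 0 one_pos hM hw, Real.rpow_one, powSum_one_zero hw,
    powSum_one_zero (mul_pos hMpos hw), expKernel]
  push_cast
  rw [Complex.cpow_zero]
  ring

lemma thetaReal_eq {w : ℝ} (hw : 0 < w) : thetaReal w = 1 + 2 * powSum 2 0 w := by
  have hpi : (Real.pi : ℂ) ≠ 0 := by exact_mod_cast Real.pi_ne_zero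
  have hτ : Complex.I * (w : ℂ) / (Real.pi : ℂ) = Complex.I * ((w / Real.pi : ℝ) : ℂ) := by
    push_cast; ring
  have him : 0 < (Complex.I * (w : ℂ) / (Real.pi : ℂ)).im := by
    rw [hτ]
    simpa using div_pos hw Real.pi_pos
  have h : powSum 2 0 w = (thetaReal w - 1) / 2 := by
    refine ((hasSum_nat_jacobiTheta him).congr_fun fun n => ?_).tsum_eq
    rw [expPowTerm, Complex.cpow_zero, one_mul, Real.rpow_two]
    congr 1
    push_cast
    field_simp
    rw [Complex.I_sq]
    ring
  rw [h]
  ring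

lemma blockSum_two_zero {M : ℕ} (hM : 0 < M) {w : ℝ} (hw : 0 < w) :
    blockSum 2 0 M w = thetaKernel M w := by
  have hMpos : (0 : ℝ) < M := by exact_mod_cast hM
  rw [blockSum_eq 0 two_pos hM hw, Real.rpow_two, thetaKernel, thetaReal_eq hw,
    thetaReal_eq (by positivity), Complex.cpow_zero]
  ring

theorem mainTheorem3 (M J : ℕ) (hM : 2 ≤ M) (z : ℝ) :
    -- the general formula, with the convergence and differentiability that it presupposes
    (∀ (a : ℝ) (b : ℂ), 0 < a → -((J : ℝ) * a) - 1 < b.re →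
      (∀ w : ℝ, 0 < w → Summable (blockTerm a b M w)) ∧
      ContDiffOn ℝ (J : WithTop ℕ∞) (blockSum a b M) (Set.Ioi 0) ∧
      HasSum
        (fun n : ℤ =>
          (M : ℂ) ^ (((J : ℂ) * (a : ℂ) + 1 + b) * ((n : ℂ) + (z : ℂ))) *
            PhiFun a b M J ((M : ℝ) ^ (a * ((n : ℝ) + z))))
        (Complex.Gamma ((1 + b) / (a : ℂ) + (J : ℂ)) / (a : ℂ))) ∧
    -- the case `a = 1`: the exponential function
    (∀ (β : ℕ) (w : ℝ), 0 < w →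
      PhiFun 1 (β : ℂ) M J w =
        (((-1) ^ (J + β) * iteratedDeriv (J + β) (expKernel M) w : ℝ) : ℂ)) ∧
    HasSum
      (fun n : ℤ =>
        (M : ℝ) ^ (((J : ℝ) + 1) * ((n : ℝ) + z)) *
          ((-1) ^ J * iteratedDeriv J (expKernel M) ((M : ℝ) ^ ((n : ℝ) + z))))
      (Nat.factorial J : ℝ) ∧
    -- the case `a = 2`: the Jacobi theta function
    (∀ (β : ℕ) (w : ℝ), 0 < w →
      PhiFun 2 (2 * (β : ℂ)) M J w =
        (-1) ^ (J + β) * iteratedDeriv (J + β) (thetaKernel M) w) ∧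
    HasSum
      (fun n : ℤ =>
        (M : ℂ) ^ ((2 * (J : ℂ) + 1) * ((n : ℂ) + (z : ℂ))) *
          ((-1) ^ J * iteratedDeriv J (thetaKernel M) ((M : ℝ) ^ (2 * ((n : ℝ) + z)))))
      (Complex.Gamma (1 / 2 + (J : ℂ)) / 2) := by
  have hM0 : 0 < M := by omega
  have hMpos : (0 : ℝ) < M := by exact_mod_cast hM0
  have hexp : ∀ (β : ℕ) (w : ℝ), 0 < w → PhiFun 1 (β : ℂ) M J w =
      (((-1) ^ (J + β) * iteratedDeriv (J + β) (expKernel M) w : ℝ) : ℂ) := by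
    intro β w hw
    have h := PhiFun_eq_iteratedDeriv one_pos hM0 (fun w hw => blockSum_one_zero hM0 hw) β J hw
    rw [iteratedDeriv_ofReal_comp, Complex.ofReal_one, one_mul] at h
    rw [h]
    push_cast
    ring
  have htheta : ∀ (β : ℕ) (w : ℝ), 0 < w → PhiFun 2 (2 * (β : ℂ)) M J w =
      (-1) ^ (J + β) * iteratedDeriv (J + β) (thetaKernel M) w := by
    intro β w hw
    have h := PhiFun_eq_iteratedDeriv two_pos hM0 (fun w hw => blockSum_two_zero hM0 hw) β J hw
    simpa using h
  refine ⟨fun a b ha hb => ⟨fun w hw => (hasSum_blockTerm b ha hM0 hw).summable,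
    contDiffOn_blockSum ha hM0 J b, hasSum_PhiFun J hM z ha hb⟩, hexp, ?_, htheta, ?_⟩
  · rw [← Complex.hasSum_ofReal]
    have h := hasSum_PhiFun (a := 1) (b := 0) J hM z one_pos
      (by have := J.cast_nonneg (α := ℝ); simp; linarith)
    rw [show (1 + 0) / ((1 : ℝ) : ℂ) + (J : ℂ) = J + 1 by push_cast; ring,
      Complex.Gamma_nat_eq_factorial, Complex.ofReal_one, div_one] at h
    rw [Complex.ofReal_natCast]
    refine h.congr_fun fun n => ?_
    have h0 := hexp 0 _ (Real.rpow_pos_of_pos hMpos ((n : ℝ) + z))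
    rw [Nat.cast_zero, add_zero] at h0
    rw [one_mul, h0, Complex.ofReal_mul, Complex.ofReal_cpow hMpos.le]
    push_cast
    congr 2
    ring
  · have h := hasSum_PhiFun (a := 2) (b := 0) J hM z two_pos
      (by have := J.cast_nonneg (α := ℝ); simp; linarith)
    simp only [add_zero, Complex.ofReal_ofNat] at h
    refine h.congr_fun fun n => ?_
    have h0 := htheta 0 _ (Real.rpow_pos_of_pos hMpos (2 * ((n : ℝ) + z)))
    rw [Nat.cast_zero, mul_zero, add_zero] at h0
    rw [h0]
    congr 2
    ring
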